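/- Let $R$ be a commutative Noetherian local ring with maximal ideal $\mathfrak m$; all modules are finitely generated. A module $N$ is called a rigid-test module if, for every module $X$ and every $n\ge 1$ with $\mathrm{Tor}^R_n(N,X)=0$, one has $\mathrm{Tor}^R_{n+1}(N,X)=0$ and $\operatorname{pd}(X)<\infty$. Let $\operatorname{depth}(N)$ be the supremum of the lengths of $N$-regular sequences in $\mathfrak m$, and let $\mathrm{syz}(N)$ be the largest $n\ge 0$ such that $N$ is isomorphic to an $n$-th syzygy module in a minimal free resolution of some $R$-module ($\infty$ if there are arbitrarily large such $n$; every module is a $0$-th syzygy of itself). Let $M$ and $N$ be nonzero $R$-modules such that $N$ is a rigid-test module and $\mathrm{syz}(N)=\operatorname{depth}(N)\le \operatorname{pd}(M)$, where $\operatorname{pd}(M)=\infty$ is allowed. Then $$\sup\{i\in\mathbb Z : \mathrm{Tor}_i^R(M,N)\neq 0\}=\operatorname{pd}(M)-\operatorname{depth}(N),$$ where both sides are $\infty$ if $\operatorname{pd}(M)=\infty$. -/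

import Mathlib

open CategoryTheory CategoryTheory.Limits

universe u

namespace RigidTest

section

variable (R : Type u) [CommRing R]

/-- `Tor_n^R(X, Y) = 0`. -/
def TorVanishes (n : ℕ) (X Y : ModuleCat.{u} R) : Prop :=
  IsZero (((Tor (ModuleCat.{u} R) n).obj X).obj Y)

/-- A module `N` is a rigid-test module if, for every finitely generated `X` and every `n ≥ 1`,
`Tor_n(N, X) = 0` implies that `Tor_{n+1}(N, X) = 0` and that `X` has finite projective
dimension. (The projective dimension of the zero module is `⊥`, which counts as finite.) -/
def IsRigidTest (N : ModuleCat.{u} R) : Prop :=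
  ∀ X : ModuleCat.{u} R, Module.Finite R X → ∀ n : ℕ, 1 ≤ n →
    TorVanishes R n N X → TorVanishes R (n + 1) N X ∧ projectiveDimension X < ⊤

/-- `sup {i | Tor_i(X, Y) ≠ 0}`: equal to `⊥` if no such `i` exists, to `⊤` if the set is
unbounded. -/
noncomputable def torSup (X Y : ModuleCat.{u} R) : WithBot ℕ∞ :=
  ⨆ (i : ℕ) (_ : ¬ TorVanishes R i X Y), ((i : ℕ∞) : WithBot ℕ∞)

/-- The projective dimension as an element of `ℕ∞`. It agrees with `projectiveDimension`
for nonzero modules, see `coe_pd`. -/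
noncomputable def pd (X : ModuleCat.{u} R) : ℕ∞ :=
  (projectiveDimension X).unbotD 0

theorem coe_pd (X : ModuleCat.{u} R) [Nontrivial X] :
    ((pd R X : ℕ∞) : WithBot ℕ∞) = projectiveDimension X := by
  unfold pd
  have h : projectiveDimension X ≠ ⊥ := by
    rw [Ne, projectiveDimension_eq_bot_iff, ModuleCat.isZero_iff_subsingleton]
    exact not_subsingleton X
  cases hx : projectiveDimension X with
  | bot => exact absurd hx h
  | coe a => rfl

variable [IsLocalRing R]

/-- The depth of a module over a local ring: the supremum of the lengths of regular sequences
contained in the maximal ideal. For sequences in the maximal ideal and nonzero finitely generated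
modules, `IsWeaklyRegular` and `IsRegular` agree; the zero module gets depth `⊤`. -/
noncomputable def depth (N : ModuleCat.{u} R) : ℕ∞ :=
  ⨆ (rs : List R) (_ : (∀ r ∈ rs, r ∈ IsLocalRing.maximalIdeal R) ∧
    RingTheory.Sequence.IsWeaklyRegular N rs), (rs.length : ℕ∞)

/-- `IsMinimalSyzygy R n X N`: the module `N` is isomorphic to the `n`-th syzygy in a minimal
free resolution of `X`. A minimal free resolution is built by choosing surjections from finite
free modules whose kernels lie in `𝔪` times the free module, and continuing with the kernels. -/
inductive IsMinimalSyzygy : ℕ → ModuleCat.{u} R → ModuleCat.{u} R → Prop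
  | zero {X N : ModuleCat.{u} R} (e : X ≃ₗ[R] N) : IsMinimalSyzygy 0 X N
  | succ {n : ℕ} {X N F : ModuleCat.{u} R} (hfree : Module.Free R F) (hfin : Module.Finite R F)
      (p : F →ₗ[R] X) (hp : Function.Surjective p)
      (hmin : LinearMap.ker p ≤ IsLocalRing.maximalIdeal R • (⊤ : Submodule R F))
      (h : IsMinimalSyzygy n (ModuleCat.of R (LinearMap.ker p)) N) : IsMinimalSyzygy (n + 1) X N

/-- The largest `n` such that `N` is an `n`-th syzygy in a minimal free resolution of some
finitely generated module, with value `⊤` if there are arbitrarily large such `n`. -/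
noncomputable def syz (N : ModuleCat.{u} R) : ℕ∞ :=
  ⨆ (n : ℕ) (_ : ∃ X : ModuleCat.{u} R, Module.Finite R X ∧ IsMinimalSyzygy R n X N), (n : ℕ∞)

end

end RigidTest

/-! If `pd M = ∞`, the test property of `N` forbids the vanishing of any `Tor_n(N, M)` with `n ≥ 1`.

Suppose `pd M = p` is finite, put `t = depth N`, and write `N` as a `t`-th minimal syzygy of `X`.
Dimension shifting gives `Tor_i(M, N) ≅ Tor_{i+t}(M, X)` for `i ≥ 1`, which is zero once `i + t >
p`. What remains is `Tor_{p-t}(M, N) ≠ 0`. For `p = t` this is `M ⊗ N ≠ 0`. For `p > t`, vanishing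
would mean `Tor_p(X, M) = 0`; the last map of a minimal resolution of `M` has entries in `𝔪` and
stays injective after tensoring with `X`, so `X` has no socle
(`hom_residue_subsingleton_of_torVanishes`). Also `p ≤ depth R`, in the form `Ext^i(k, R) = 0` for
`i < p` (`ext_residue_ring_subsingleton`). Each syzygy then gains one degree of `Ext(k,
-)`-vanishing, so `depth N ≥ t + 1`, a contradiction. -/

namespace RigidTest

/-! ### Dimension shifting for left derived functors by splicing resolutions -/

section Resolution

variable {C : Type*} [Category* C] [Abelian C]

/-- The augmentation of a projective resolution. -/
noncomputable def augmentation {Z : C} (Q : ProjectiveResolution Z) : Q.complex.X 0 ⟶ Z :=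
  Q.π.f 0

instance {Z : C} (Q : ProjectiveResolution Z) : Epi (augmentation Q) :=
  inferInstanceAs (Epi (Q.π.f 0))

theorem d_comp_augmentation {Z : C} (Q : ProjectiveResolution Z) :
    Q.complex.d 1 0 ≫ augmentation Q = 0 :=
  Q.complex_d_comp_π_f_zero

theorem exact_d_augmentation {Z : C} (Q : ProjectiveResolution Z) :
    (ShortComplex.mk (Q.complex.d 1 0) (augmentation Q) (d_comp_augmentation Q)).Exact :=
  ShortComplex.exact_of_g_is_cokernel _ Q.isColimitCokernelCofork

/-- The complex obtained by splicing a projective resolution of the first term of a short exact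
sequence with its middle term. -/
noncomputable def spliceComplex {S : ShortComplex C} (Q : ProjectiveResolution S.X₁) :
    ChainComplex C ℕ :=
  Q.complex.augment (augmentation Q ≫ S.f) (by
    rw [← Category.assoc, d_comp_augmentation, zero_comp])

theorem exact_of_epi_comp {S : ShortComplex C} (hS : S.Exact) {A : C} (e : A ⟶ S.X₁) [Epi e] :
    (ShortComplex.mk (e ≫ S.f) S.g (by simp)).Exact := by
  let φ : ShortComplex.mk (e ≫ S.f) S.g (by simp) ⟶ S :=
    { τ₁ := e
      τ₂ := 𝟙 _
      τ₃ := 𝟙 _ }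
  rwa [ShortComplex.exact_iff_of_epi_of_isIso_of_mono φ]

theorem exact_of_comp_mono {S : ShortComplex C} (hS : S.Exact) {A : C} (e : S.X₃ ⟶ A) [Mono e] :
    (ShortComplex.mk S.f (S.g ≫ e) (by simp)).Exact := by
  let φ : S ⟶ ShortComplex.mk S.f (S.g ≫ e) (by simp) :=
    { τ₁ := 𝟙 _
      τ₂ := 𝟙 _
      τ₃ := e }
  rwa [← ShortComplex.exact_iff_of_epi_of_isIso_of_mono φ]

/-- Since `S.g` is a cokernel of `S.f`, exactness of the new complex says that the map induced by
`S.g ≫ e` on that cokernel, which is `e` up to isomorphism, is mono. -/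
theorem exact_comp_iff_mono {S : ShortComplex C} (hS : S.Exact) [Epi S.g] {A : C} (e : S.X₃ ⟶ A) :
    (ShortComplex.mk S.f (S.g ≫ e) (by simp)).Exact ↔ Mono e := by
  refine ⟨fun h => ?_, fun _ => exact_of_comp_mono hS e⟩
  have h₁ := S.exact_iff_mono_cokernel_desc.1 hS
  have h₂ : Epi (cokernel.desc S.f S.g S.zero) := epi_of_epi_fac (cokernel.π_desc S.f S.g S.zero)
  have h₃ : IsIso (cokernel.desc S.f S.g S.zero) := isIso_of_mono_of_epi _
  have h₄ := (ShortComplex.exact_iff_mono_cokernel_desc _).1 h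
  have h₅ : e = inv (cokernel.desc S.f S.g S.zero) ≫
      cokernel.desc S.f (S.g ≫ e) (by simp) := by
    rw [IsIso.eq_inv_comp]
    ext
    simp
  rw [h₅]
  exact mono_comp' inferInstance h₄

theorem quasiIsoAt_zero_toSingle₀ (K : ChainComplex C ℕ) {Z : C} (g : K.X 0 ⟶ Z) [Epi g]
    (w : K.d 1 0 ≫ g = 0) (h : (ShortComplex.mk _ _ w).Exact) :
    QuasiIsoAt ((ChainComplex.toSingle₀Equiv K Z).symm ⟨g, w⟩) 0 := by
  have hg : ((ChainComplex.toSingle₀Equiv K Z).symm ⟨g, w⟩).f 0 = g :=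
    ChainComplex.toSingle₀Equiv_symm_apply_f_zero g w
  rw [ChainComplex.quasiIsoAt₀_iff, ShortComplex.quasiIso_iff_of_zeros']
  · refine (ShortComplex.exact_and_epi_g_iff_of_iso ?_).2 ⟨h, ‹Epi g›⟩
    exact ShortComplex.isoMk (Iso.refl _) (Iso.refl _) (Iso.refl _)
      ((Category.id_comp _).trans (Category.comp_id _).symm)
      ((Category.id_comp _).trans (hg.symm.trans (Category.comp_id _).symm))
  · exact K.shape _ _ (by simp)
  all_goals rfl

/-- A projective resolution of the cokernel in a short exact sequence with projective middle term,
from one of its kernel. -/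
noncomputable def spliceResolution {S : ShortComplex C} (hS : S.ShortExact) [Projective S.X₂]
    (Q : ProjectiveResolution S.X₁) : ProjectiveResolution S.X₃ where
  complex := spliceComplex Q
  projective n := by
    cases n
    · exact ‹Projective S.X₂›
    · exact Q.projective _
  π := (ChainComplex.toSingle₀Equiv _ _).symm ⟨S.g, by
    change (augmentation Q ≫ S.f) ≫ S.g = 0
    rw [Category.assoc, S.zero, comp_zero]⟩
  quasiIso := ⟨fun n => by
    have := hS.mono_f
    have := hS.epi_g
    cases n with
    | zero =>
      have : Epi (show (spliceComplex Q).X 0 ⟶ S.X₃ from S.g) := hS.epi_g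
      exact quasiIsoAt_zero_toSingle₀ (spliceComplex Q) S.g _
        (exact_of_epi_comp hS.exact (augmentation Q))
    | succ n =>
      rw [quasiIsoAt_iff_exactAt']
      · rw [HomologicalComplex.exactAt_iff' _ (n + 1 + 1) (n + 1) n (by simp) (by simp)]
        cases n with
        | zero => exact exact_of_comp_mono (exact_d_augmentation Q) S.f
        | succ n => exact Q.exact_succ n
      · apply ChainComplex.exactAt_succ_single_obj⟩

theorem isZero_leftDerived_iff {D : Type*} [Category* D] [Abelian D] [HasProjectiveResolutions C]
    (F : C ⥤ D) [F.Additive] {Z : C} (Q : ProjectiveResolution Z) (n : ℕ) :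
    IsZero ((F.leftDerived (n + 1)).obj Z) ↔
      (ShortComplex.mk (F.map (Q.complex.d (n + 2) (n + 1))) (F.map (Q.complex.d (n + 1) n))
        (by rw [← F.map_comp, Q.complex.d_comp_d, F.map_zero])).Exact := by
  rw [(Q.isoLeftDerivedObj F (n + 1)).isZero_iff]
  change IsZero (HomologicalComplex.homology _ _) ↔ _
  rw [← HomologicalComplex.exactAt_iff_isZero_homology,
    HomologicalComplex.exactAt_iff' _ (n + 2) (n + 1) n (by simp) (by simp)]
  rfl

theorem isZero_leftDerived_succ_succ_iff {D : Type*} [Category* D] [Abelian D]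
    [HasProjectiveResolutions C] (F : C ⥤ D) [F.Additive] {S : ShortComplex C} (hS : S.ShortExact)
    [Projective S.X₂] (n : ℕ) :
    IsZero ((F.leftDerived (n + 2)).obj S.X₃) ↔ IsZero ((F.leftDerived (n + 1)).obj S.X₁) := by
  let Q := projectiveResolution S.X₁
  rw [isZero_leftDerived_iff F Q, isZero_leftDerived_iff F (spliceResolution hS Q)]
  -- The spliced resolution is `Q` moved up one degree, so both sides are the same exactness
  -- condition.
  rfl

/-- Right exactness presents `F(S.X₁)` as the cokernel of `F(Q₁) ⟶ F(Q₀)`, so exactness at `F(Q₀)`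
on the way to `F(S.X₂)` tests whether `F(S.f)` is mono. -/
theorem isZero_leftDerived_one_iff {D : Type*} [Category* D] [Abelian D]
    [HasProjectiveResolutions C] (F : C ⥤ D) [F.Additive] [PreservesFiniteColimits F]
    {S : ShortComplex C} (hS : S.ShortExact) [Projective S.X₂] :
    IsZero ((F.leftDerived 1).obj S.X₃) ↔ Mono (F.map S.f) := by
  let Q := projectiveResolution S.X₁
  rw [isZero_leftDerived_iff F (spliceResolution hS Q)]
  have hF := ((Functor.preservesFiniteColimits_tfae F).out 3 1).1 ‹_›
  obtain ⟨h, h'⟩ := hF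
    (ShortComplex.mk _ _ (d_comp_augmentation Q)) ⟨exact_d_augmentation Q, inferInstance⟩
  refine Iff.trans ?_ (@exact_comp_iff_mono _ _ _ _ h h' _ (F.map S.f))
  change (ShortComplex.mk (F.map (Q.complex.d 1 0)) (F.map (augmentation Q ≫ S.f)) _).Exact ↔
    (ShortComplex.mk (F.map (Q.complex.d 1 0)) (F.map (augmentation Q) ≫ F.map S.f) _).Exact
  simp only [F.map_comp]

end Resolution


/-! ### Vanishing of Tor in low degrees -/

section Tor

variable {R : Type u} [CommRing R]

theorem torVanishes_succ_succ_iff (X : ModuleCat.{u} R) {S : ShortComplex (ModuleCat.{u} R)}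
    (hS : S.ShortExact) [Projective S.X₂] (n : ℕ) :
    TorVanishes R (n + 2) X S.X₃ ↔ TorVanishes R (n + 1) X S.X₁ :=
  isZero_leftDerived_succ_succ_iff _ hS n

theorem torVanishes_one_iff (X : ModuleCat.{u} R) {S : ShortComplex (ModuleCat.{u} R)}
    (hS : S.ShortExact) [Projective S.X₂] :
    TorVanishes R 1 X S.X₃ ↔ Function.Injective (S.f.hom.lTensor X) := by
  have : PreservesFiniteColimits ((MonoidalCategory.tensoringLeft (ModuleCat.{u} R)).obj X) :=
    inferInstanceAs (PreservesFiniteColimits (MonoidalCategory.tensorLeft X))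
  refine (isZero_leftDerived_one_iff _ hS).trans ?_
  rw [ModuleCat.mono_iff_injective]
  rfl

theorem torVanishes_zero_iff (X Y : ModuleCat.{u} R) :
    TorVanishes R 0 X Y ↔ Subsingleton (TensorProduct R X Y) := by
  have : PreservesFiniteColimits ((MonoidalCategory.tensoringLeft (ModuleCat.{u} R)).obj X) :=
    inferInstanceAs (PreservesFiniteColimits (MonoidalCategory.tensorLeft X))
  rw [← ModuleCat.isZero_of_iff_subsingleton (R := R)]
  exact ((((MonoidalCategory.tensoringLeft (ModuleCat.{u} R)).obj X).leftDerivedZeroIsoSelf).app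
    Y).isZero_iff

end Tor

/-! ### Symmetry of Tor vanishing -/

section Tor

variable {R : Type u} [CommRing R]

theorem flat_of_projective (P : ModuleCat.{u} R) [Projective P] : Module.Flat R P := by
  have := (IsProjective.iff_projective (R := R) P).2 ‹_›
  infer_instance

/-- A chase in the 3×3 diagram of tensor products of the two sequences, using flatness of `S.X₂` for
its middle line. -/
theorem lTensor_injective_swap {S T : ShortComplex (ModuleCat.{u} R)} (hS : S.ShortExact)
    (hT : T.ShortExact) [Projective S.X₂]
    (h : Function.Injective (S.f.hom.lTensor T.X₃)) :
    Function.Injective (T.f.hom.lTensor S.X₃) := by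
  have := flat_of_projective S.X₂
  refine lTensor_injective_of_exact_of_exact_of_rTensor_injective
    ((ShortComplex.ShortExact.moduleCat_exact_iff_function_exact S).1 hS.exact)
    hS.moduleCat_surjective_g
    ((ShortComplex.ShortExact.moduleCat_exact_iff_function_exact T).1 hT.exact)
    hT.moduleCat_surjective_g
    ((LinearMap.lTensor_inj_iff_rTensor_inj _ _).1 h) ?_
  exact Module.Flat.lTensor_preserves_injective_linearMap _ hT.moduleCat_injective_f

theorem torVanishes_one_comm (M X : ModuleCat.{u} R) :
    TorVanishes R 1 M X ↔ TorVanishes R 1 X M := by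
  suffices h : ∀ M X : ModuleCat.{u} R, TorVanishes R 1 M X → TorVanishes R 1 X M from
    ⟨h M X, h X M⟩
  intro M X h
  exact (torVanishes_one_iff X M.shortExact_projectiveShortComplex).2
    (lTensor_injective_swap X.shortExact_projectiveShortComplex
      M.shortExact_projectiveShortComplex
      ((torVanishes_one_iff M X.shortExact_projectiveShortComplex).1 h))

theorem lTensor_injective_iff_map {S T : ShortComplex (ModuleCat.{u} R)} (hS : S.ShortExact)
    [Projective T.X₂] :
    Function.Injective (T.f.hom.lTensor S.X₁) ↔
      Function.Injective (TensorProduct.map S.f.hom T.f.hom) := by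
  have := flat_of_projective T.X₂
  have h : Function.Injective (S.f.hom.rTensor T.X₂) :=
    Module.Flat.rTensor_preserves_injective_linearMap _ hS.moduleCat_injective_f
  rw [← LinearMap.rTensor_comp_lTensor, LinearMap.coe_comp, h.of_comp_iff]

/-- Both sides say that `S.X₁ ⊗ T.X₁ → S.X₂ ⊗ T.X₂` is injective, up to swapping factors. -/
theorem torVanishes_one_syzygy_comm {S T : ShortComplex (ModuleCat.{u} R)} (hS : S.ShortExact)
    (hT : T.ShortExact) [Projective S.X₂] [Projective T.X₂] :
    TorVanishes R 1 S.X₁ T.X₃ ↔ TorVanishes R 1 T.X₁ S.X₃ := by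
  rw [torVanishes_one_iff _ hT, torVanishes_one_iff _ hS, lTensor_injective_iff_map hS,
    lTensor_injective_iff_map hT]
  have h : ⇑(TensorProduct.comm R _ _) ∘ ⇑(TensorProduct.map S.f.hom T.f.hom) =
      ⇑(TensorProduct.map T.f.hom S.f.hom) ∘ ⇑(TensorProduct.comm R _ _) :=
    funext fun x => (TensorProduct.map_comm _ _ x).symm
  rw [← (TensorProduct.comm R _ _).injective.of_comp_iff, h]
  exact (TensorProduct.comm R _ _).toEquiv.injective_comp _

/-- `Tor` is derived in its second variable, so shifting in the first needs symmetry in lower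
degrees. In degree 2 a second shift would reach `Tor_0`; there the comparison of `Tor_1` of syzygies
replaces it. -/
theorem torVanishes_succ_comm (n : ℕ) (M X : ModuleCat.{u} R) :
    TorVanishes R (n + 1) M X ↔ TorVanishes R (n + 1) X M := by
  induction n using Nat.strong_induction_on generalizing M X with
  | _ n ih =>
    have hM := M.shortExact_projectiveShortComplex
    have hX := X.shortExact_projectiveShortComplex
    match n with
    | 0 => exact torVanishes_one_comm M X
    | 1 =>
      refine (torVanishes_succ_succ_iff M hX 0).trans <| (ih 0 (by lia) _ _).trans <|
        (torVanishes_one_syzygy_comm hX hM).trans <| (ih 0 (by lia) _ _).trans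
        (torVanishes_succ_succ_iff X hM 0).symm
    | n + 2 =>
      refine (torVanishes_succ_succ_iff M hX (n + 1)).trans <|
        (ih (n + 1) (by lia) _ _).trans <|
        (torVanishes_succ_succ_iff _ hM n).trans <|
        (ih n (by lia) _ _).trans <|
        (torVanishes_succ_succ_iff _ hX n).symm.trans <|
        (ih (n + 1) (by lia) _ _).trans
        (torVanishes_succ_succ_iff X hM (n + 1)).symm

theorem torVanishes_of_hasProjectiveDimensionLT (X M : ModuleCat.{u} R) (n : ℕ)
    (h : HasProjectiveDimensionLT M (n + 1)) : TorVanishes R (n + 1) X M := by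
  induction n generalizing M with
  | zero =>
    have : Projective M := projective_iff_hasProjectiveDimensionLT_one.2 h
    exact isZero_Tor_succ_of_projective (ModuleCat.{u} R) X M 0
  | succ n ih =>
    have hM := M.shortExact_projectiveShortComplex
    exact (torVanishes_succ_succ_iff X hM n).2
      (ih _ ((hM.hasProjectiveDimensionLT_X₃_iff n inferInstance).1 h))

theorem torVanishes_congr_right (X : ModuleCat.{u} R) (n : ℕ) {M N : ModuleCat.{u} R}
    (e : M ≃ₗ[R] N) : TorVanishes R n X M ↔ TorVanishes R n X N :=
  (((Tor (ModuleCat.{u} R) n).obj X).mapIso e.toModuleIso).isZero_iff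

theorem IsMinimalSyzygy.torVanishes_iff [IsLocalRing R] {t : ℕ} {X N : ModuleCat.{u} R}
    (h : IsMinimalSyzygy R t X N) (M : ModuleCat.{u} R) (n : ℕ) :
    TorVanishes R (n + 1) M N ↔ TorVanishes R (n + t + 1) M X := by
  induction h with
  | zero e => exact (torVanishes_congr_right M _ e).symm
  | @succ t X N F hfree hfin p hp hmin h ih =>
    have : Projective (ModuleCat.of R F) := (IsProjective.iff_projective (R := R) F).1 Module.Projective.of_free
    exact ih.trans
      (torVanishes_succ_succ_iff M (LinearMap.shortExact_shortComplexKer hp) (n + t)).symm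

end Tor

/-! ### Maps between free modules and Ext into free modules -/

section Free

open Abelian

variable {R : Type u} [CommRing R]

theorem mem_smul_top_of_range_le {K F : Type u} [AddCommGroup K] [Module R K] [AddCommGroup F]
    [Module R F] [Module.Free R K] [Module.Finite R K] (I : Ideal R) (f : K →ₗ[R] F)
    (hf : LinearMap.range f ≤ I • ⊤) : f ∈ I • (⊤ : Submodule R (K →ₗ[R] F)) := by
  let b := Module.Free.chooseBasis R K
  have h : f = ∑ j, LinearMap.smulRightₗ (b.coord j) (f (b j)) := by
    refine b.ext fun i => ?_
    simp [Finsupp.single_apply, Finset.sum_ite_eq]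
  rw [h]
  refine Submodule.sum_mem _ fun j _ => ?_
  have := Submodule.mem_map_of_mem (f := LinearMap.smulRightₗ (R := R) (M := F) (b.coord j))
    (hf ⟨b j, rfl⟩)
  rw [Submodule.map_smul''] at this
  exact Submodule.smul_mono le_rfl le_top this

theorem ext_subsingleton_of_free {Z F : ModuleCat.{u} R} [Module.Free R F] [Module.Finite R F]
    {n : ℕ} (h : Subsingleton (Ext Z (ModuleCat.of R R) n)) : Subsingleton (Ext Z F n) := by
  let b := Module.Free.chooseBasis R F
  refine subsingleton_of_forall_eq 0 fun α => ?_
  have h₁ : 𝟙 F = ∑ j, (ModuleCat.ofHom (b.coord j) : F ⟶ ModuleCat.of R R) ≫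
      ModuleCat.ofHom (LinearMap.toSpanSingleton R F (b j)) := by
    ext x
    simp [ModuleCat.hom_sum, b.sum_repr]
  rw [← Ext.comp_mk₀_id α, h₁, Ext.mk₀_sum, Ext.comp_sum]
  refine Finset.sum_eq_zero fun j _ => ?_
  rw [← Ext.mk₀_comp_mk₀, ← Ext.comp_assoc_of_second_deg_zero,
    Subsingleton.elim (α.comp (Ext.mk₀ _) _) 0, Ext.zero_comp]

theorem ext_nontrivial_of_free {Z F : ModuleCat.{u} R} [Module.Free R F] [Nontrivial F]
    {n : ℕ} (h : Nontrivial (Ext Z (ModuleCat.of R R) n)) : Nontrivial (Ext Z F n) := by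
  let b := Module.Free.chooseBasis R F
  obtain ⟨j⟩ := b.index_nonempty
  let i : ModuleCat.of R R ⟶ F := ModuleCat.ofHom (LinearMap.toSpanSingleton R F (b j))
  let r : F ⟶ ModuleCat.of R R := ModuleCat.ofHom (b.coord j)
  have hr : i ≫ r = 𝟙 _ := by
    ext
    simp [i, r]
  refine Function.Injective.nontrivial (f := fun α : Ext Z (ModuleCat.of R R) n => α.comp (Ext.mk₀ i) (add_zero n)) ?_
  refine Function.LeftInverse.injective (g := fun α : Ext Z F n => α.comp (Ext.mk₀ r) (add_zero n)) fun α => ?_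
  simp only
  rw [Ext.comp_assoc_of_second_deg_zero, Ext.mk₀_comp_mk₀, hr, Ext.comp_mk₀_id]

end Free

/-! ### Minimal covers and the action of 𝔪 on Ext from the residue field -/

section Local

open IsLocalRing

variable {R : Type u} [CommRing R] [IsLocalRing R]

theorem exists_minimal_cover (X : ModuleCat.{u} R) [Module.Finite R X] :
    ∃ (F : ModuleCat.{u} R) (p : F →ₗ[R] X), Module.Free R F ∧ Module.Finite R F ∧
      Function.Surjective p ∧ LinearMap.ker p ≤ maximalIdeal R • (⊤ : Submodule R F) := by
  obtain ⟨ι, _, ⟨b⟩⟩ : ∃ (ι : Type u) (_ : Fintype ι),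
      Nonempty (Module.Basis ι (ResidueField R) (TensorProduct R (ResidueField R) X)) := by
    have : Module.Free (ResidueField R) (TensorProduct R (ResidueField R) X) :=
      Module.Free.of_divisionRing _ _
    have : Module.Finite (ResidueField R) (TensorProduct R (ResidueField R) X) :=
      Module.Finite.base_change R (ResidueField R) X
    exact ⟨_, inferInstance, ⟨Module.Free.chooseBasis _ _⟩⟩
  have hs := TensorProduct.mk_surjective R X (ResidueField R) Ideal.Quotient.mk_surjective
  choose f hf using fun i : ι => hs (b i)
  classical
  refine ⟨ModuleCat.of R (ι → R), Fintype.linearCombination R f, inferInstance, inferInstance,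
    ?_, ?_⟩
  · rw [← LinearMap.range_eq_top, Fintype.range_linearCombination]
    exact span_eq_top_of_tmul_eq_basis f b hf
  · intro c hc
    have h₀ : ∑ i, residue R (c i) • b i = 0 := by
      have := congrArg (TensorProduct.mk R (ResidueField R) X 1) (LinearMap.mem_ker.1 hc)
      rw [Fintype.linearCombination_apply, map_sum, map_zero] at this
      rw [← this]
      refine Finset.sum_congr rfl fun i _ => ?_
      rw [map_smul, hf]
      exact algebraMap_smul (ResidueField R) (c i) (b i)
    -- A relation among the generators reduces to one among basis vectors of `k ⊗ X`, so its
    -- coefficients lie in `𝔪`.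
    have h₁ := Fintype.linearIndependent_iff.1 b.linearIndependent _ h₀
    change (c : ι → R) ∈ maximalIdeal R • (⊤ : Submodule R (ι → R))
    rw [pi_eq_sum_univ' c]
    exact Submodule.sum_mem _ fun i _ =>
      Submodule.smul_mem_smul ((residue_eq_zero_iff _).1 (h₁ i)) trivial

variable (R) in
/-- The residue field, as an object of `ModuleCat R`. -/
abbrev residueModule : ModuleCat.{u} R := ModuleCat.of R (R ⧸ maximalIdeal R)

open Abelian

theorem smul_ext_residue {r : R} (hr : r ∈ maximalIdeal R) {Y : ModuleCat.{u} R} {n : ℕ}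
    (α : Ext (residueModule R) Y n) : r • α = 0 := by
  have h : r • 𝟙 (residueModule R) = 0 := by
    ext
    exact Ideal.Quotient.eq_zero_iff_mem.2 (by simpa using hr)
  have : r • α = (Ext.mk₀ (r • 𝟙 (residueModule R))).comp α (zero_add n) := by simp [Ext.mk₀_smul]
  rw [this, h, Ext.mk₀_zero, Ext.zero_comp]

/-- As `K` is finite free, `f` is an `𝔪`-combination of maps `K ⟶ F`, and `𝔪` annihilates `Ext(k,
-)`. -/
theorem ext_residue_comp_eq_zero {K F : ModuleCat.{u} R} [Module.Free R K] [Module.Finite R K]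
    (f : K ⟶ F) (hf : LinearMap.range f.hom ≤ maximalIdeal R • ⊤) {n : ℕ}
    (α : Ext (residueModule R) K n) : α.comp (Ext.mk₀ f) (add_zero n) = 0 := by
  suffices h : ∀ g ∈ maximalIdeal R • (⊤ : Submodule R (K →ₗ[R] F)),
      α.comp (Ext.mk₀ (ModuleCat.ofHom g)) (add_zero n) = 0 from
    h f.hom (mem_smul_top_of_range_le _ _ hf)
  intro g hg
  induction hg using Submodule.smul_induction_on' with
  | smul r hr g _ =>
    rw [show ModuleCat.ofHom (r • g) = r • ModuleCat.ofHom g from rfl, Ext.mk₀_smul, Ext.comp_smul, smul_ext_residue hr]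
  | add g _ g' _ h h' => rw [ModuleCat.ofHom_add, Ext.mk₀_add, Ext.comp_add, h, h', add_zero]

end Local

/-! ### Projective dimension, syzygies and Ext from the residue field -/

section Local

open IsLocalRing Abelian

variable {R : Type u} [CommRing R]

theorem syzygy_projectiveDimension {S : ShortComplex (ModuleCat.{u} R)} (hS : S.ShortExact)
    [Projective S.X₂] {n : ℕ} (h : HasProjectiveDimensionLT S.X₃ (n + 2))
    (h' : ¬ HasProjectiveDimensionLT S.X₃ (n + 1)) :
    HasProjectiveDimensionLT S.X₁ (n + 1) ∧ ¬ HasProjectiveDimensionLT S.X₁ n :=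
  ⟨(hS.hasProjectiveDimensionLT_X₃_iff n inferInstance).1 h, fun h₁ =>
    h' (hS.hasProjectiveDimensionLT_X₃ n h₁ (hasProjectiveDimensionLT_of_ge _ 1 _ (by lia)))⟩

theorem nontrivial_of_not_hasProjectiveDimensionLT {K : ModuleCat.{u} R} {n : ℕ}
    (h : ¬ HasProjectiveDimensionLT K n) : Nontrivial K := by
  by_contra hK
  rw [not_nontrivial_iff_subsingleton] at hK
  have := ((ModuleCat.isZero_iff_subsingleton (M := K)).2 hK).hasProjectiveDimensionLT_zero
  exact h (hasProjectiveDimensionLT_of_ge K 0 n (Nat.zero_le n))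

variable [IsLocalRing R]

theorem free_of_hasProjectiveDimensionLT_one {K : ModuleCat.{u} R} [Module.Finite R K]
    (h : HasProjectiveDimensionLT K 1) : Module.Free R K := by
  have : Projective K := projective_iff_hasProjectiveDimensionLT_one.2 h
  have := flat_of_projective K
  exact Module.free_of_flat_of_isLocalRing

variable {d : ℕ}

/-- Either `q = 0`, `K` is free and minimality applies, or `e < d` and `Ext^e(k, F)` is already
zero. -/
theorem ext_residue_syzygy_comp_eq_zero
    (hlt : ∀ i < d, Subsingleton (Ext (residueModule R) (ModuleCat.of R R) i))
    {K F : ModuleCat.{u} R} [Module.Finite R K] [Module.Free R F] [Module.Finite R F] (f : K ⟶ F)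
    (hf : LinearMap.range f.hom ≤ maximalIdeal R • ⊤) {q e : ℕ} (hqe : q + e = d)
    (hK : HasProjectiveDimensionLT K (q + 1)) (α : Ext (residueModule R) K e) :
    α.comp (Ext.mk₀ f) (add_zero e) = 0 := by
  cases q with
  | zero =>
    have := free_of_hasProjectiveDimensionLT_one hK
    exact ext_residue_comp_eq_zero f hf α
  | succ q =>
    have : Subsingleton (Ext (residueModule R) F e) :=
      ext_subsingleton_of_free (hlt e (by lia))
    exact Subsingleton.elim _ _

theorem IsMinimalSyzygy.ext_residue_subsingleton {t s : ℕ} {X N : ModuleCat.{u} R}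
    (h : IsMinimalSyzygy R t X N)
    (hR : ∀ i < s + t, Subsingleton (Ext (residueModule R) (ModuleCat.of R R) i))
    (hX : ∀ i < s, Subsingleton (Ext (residueModule R) X i)) :
    ∀ i < s + t, Subsingleton (Ext (residueModule R) N i) := by
  induction h generalizing s with
  | @zero X N e =>
    intro i hi
    have := hX i hi
    refine subsingleton_of_forall_eq 0 fun α => ?_
    rw [← Ext.comp_mk₀_id α, ← e.toModuleIso.inv_hom_id, ← Ext.mk₀_comp_mk₀,
      ← Ext.comp_assoc_of_second_deg_zero, Subsingleton.elim (α.comp (Ext.mk₀ _) _) 0,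
      Ext.zero_comp]
  | @succ t X N F hfree hfin p hp hmin h ih =>
    have hS := LinearMap.shortExact_shortComplexKer hp
    have := hS.mono_f
    have hF : ∀ i < s + (t + 1), Subsingleton (Ext (residueModule R) (ModuleCat.of R F) i) :=
      fun i hi => ext_subsingleton_of_free (F := ModuleCat.of R F) (hR i hi)
    intro i hi
    -- Replacing `X` by its first syzygy trades one step of `t` for one more degree of vanishing.
    refine ih (s := s + 1) (fun i hi => hR i (by lia)) (fun i hi => ?_) i (by lia)
    have hFi := hF i (by lia)
    refine subsingleton_of_forall_eq 0 fun α => ?_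
    have h₀ : α.comp (Ext.mk₀ p.shortComplexKer.f) (add_zero i) = 0 :=
      hFi.elim _ _
    cases i with
    | zero =>
      exact Ext.postcomp_mk₀_injective_of_mono _ p.shortComplexKer.f
        (h₀.trans (Ext.zero_comp _ _ _ _ (add_zero 0)).symm)
    | succ i =>
      obtain ⟨β, hβ⟩ := Ext.covariant_sequence_exact₁ _ hS α h₀ rfl
      rw [← hβ, (hX i (by lia)).elim β 0, Ext.zero_comp]

variable [IsNoetherianRing R]

/-- One half of Auslander–Buchsbaum, with `d = depth R`: a nonzero class of the syzygy in degree `e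
+ 1` dies in the free cover, hence comes from `Ext^e(k, Y)`. -/
theorem ext_residue_nontrivial
    (hlt : ∀ i < d, Subsingleton (Ext (residueModule R) (ModuleCat.of R R) i))
    (hd : Nontrivial (Ext (residueModule R) (ModuleCat.of R R) d))
    (Y : ModuleCat.{u} R) [Module.Finite R Y] {q e : ℕ} (hqe : q + e = d)
    (hY : HasProjectiveDimensionLT Y (q + 1)) (hY' : ¬ HasProjectiveDimensionLT Y q) :
    Nontrivial (Ext (residueModule R) Y e) := by
  induction q generalizing Y e with
  | zero =>
    have := free_of_hasProjectiveDimensionLT_one hY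
    have := nontrivial_of_not_hasProjectiveDimensionLT hY'
    obtain rfl : e = d := by lia
    exact ext_nontrivial_of_free hd
  | succ q ih =>
    obtain ⟨F, p, _, _, hp, hmin⟩ := exists_minimal_cover Y
    have hS := LinearMap.shortExact_shortComplexKer hp
    have : Projective (ModuleCat.of R F) :=
      (IsProjective.iff_projective (R := R) F).1 Module.Projective.of_free
    obtain ⟨hK, hK'⟩ := syzygy_projectiveDimension hS hY hY'
    have := ih (ModuleCat.of R (LinearMap.ker p)) (e := e + 1) (by lia) hK hK'
    obtain ⟨α, hα⟩ := exists_ne (0 : Ext (residueModule R) (ModuleCat.of R (LinearMap.ker p)) (e + 1))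
    have h₀ : α.comp (Ext.mk₀ p.shortComplexKer.f) (add_zero (e + 1)) = 0 :=
      ext_residue_syzygy_comp_eq_zero (F := ModuleCat.of R F) hlt p.shortComplexKer.f
        ((Submodule.range_subtype _).trans_le hmin) (by lia) hK α
    obtain ⟨β, hβ⟩ := Ext.covariant_sequence_exact₁ _ hS α h₀ rfl
    refine ⟨β, 0, fun h => hα ?_⟩
    rw [← hβ, h, Ext.zero_comp]

/-- The inequality `pd Y ≤ depth R` for modules of finite projective dimension. -/
theorem projectiveDimension_le_of_ext_residue_nontrivial
    (hlt : ∀ i < d, Subsingleton (Ext (residueModule R) (ModuleCat.of R R) i))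
    (hd : Nontrivial (Ext (residueModule R) (ModuleCat.of R R) d))
    (Y : ModuleCat.{u} R) [Module.Finite R Y] {q : ℕ}
    (hY : HasProjectiveDimensionLT Y (q + 1)) (hY' : ¬ HasProjectiveDimensionLT Y q) : q ≤ d := by
  induction q generalizing Y with
  | zero => exact Nat.zero_le d
  | succ q ih =>
    obtain ⟨F, p, _, _, hp, hmin⟩ := exists_minimal_cover Y
    have hS := LinearMap.shortExact_shortComplexKer hp
    have : Projective (ModuleCat.of R F) :=
      (IsProjective.iff_projective (R := R) F).1 Module.Projective.of_free
    obtain ⟨hK, hK'⟩ := syzygy_projectiveDimension hS hY hY'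
    refine lt_of_le_of_ne (ih (ModuleCat.of R (LinearMap.ker p)) hK hK') ?_
    -- If the syzygy had projective dimension `d`, it would have a nonzero socle element, which the
    -- inclusion into the cover would both kill and preserve.
    rintro rfl
    have := ext_residue_nontrivial hlt hd (ModuleCat.of R (LinearMap.ker p)) (e := 0) rfl hK hK'
    obtain ⟨α, hα⟩ := exists_ne (0 : Ext (residueModule R) (ModuleCat.of R (LinearMap.ker p)) 0)
    have h₀ : α.comp (Ext.mk₀ p.shortComplexKer.f) (add_zero 0) = 0 :=
      ext_residue_syzygy_comp_eq_zero (F := ModuleCat.of R F) hlt p.shortComplexKer.f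
        ((Submodule.range_subtype _).trans_le hmin) rfl hK α
    have := hS.mono_f
    exact hα (Ext.postcomp_mk₀_injective_of_mono _ p.shortComplexKer.f
      (h₀.trans (Ext.zero_comp _ _ _ _ (add_zero 0)).symm))

/-- The least `i` with `Ext^i(k, R) ≠ 0` serves as `d` in the preceding bound, whence `q ≤ i`. -/
theorem ext_residue_ring_subsingleton (Y : ModuleCat.{u} R) [Module.Finite R Y] {q : ℕ}
    (hY : HasProjectiveDimensionLT Y (q + 1)) (hY' : ¬ HasProjectiveDimensionLT Y q) {i : ℕ}
    (hi : i < q) : Subsingleton (Ext (residueModule R) (ModuleCat.of R R) i) := by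
  induction i using Nat.strong_induction_on with
  | _ i ih =>
    by_contra h
    exact hi.not_ge (projectiveDimension_le_of_ext_residue_nontrivial
      (fun j hj => ih j hj (hj.trans hi)) (not_subsingleton_iff_nontrivial.1 h) Y hY hY')

end Local

/-! ### Depth, socles and attained suprema -/

section Depth

open IsLocalRing Abelian
open scoped TensorProduct

variable {R : Type u} [CommRing R] [IsLocalRing R]

theorem smul_top_lt_top (N : ModuleCat.{u} R) [Module.Finite R N] [Nontrivial N] :
    maximalIdeal R • (⊤ : Submodule R N) < ⊤ :=
  (Submodule.top_ne_ideal_smul_of_le_jacobson_annihilator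
    (maximalIdeal_le_jacobson _)).symm.lt_top

theorem exists_isMinimalSyzygy_of_syz_eq (N : ModuleCat.{u} R) [Module.Finite R N] {t : ℕ}
    (h : syz R N = t) : ∃ X : ModuleCat.{u} R, Module.Finite R X ∧ IsMinimalSyzygy R t X N := by
  let s : Set ℕ := {n | ∃ X : ModuleCat.{u} R, Module.Finite R X ∧ IsMinimalSyzygy R n X N}
  have hs : s.Nonempty := ⟨0, N, ‹_›, .zero (LinearEquiv.refl R N)⟩
  have hle : ∀ n ∈ s, n ≤ t := fun n hn => by
    have : (n : ℕ∞) ≤ syz R N := le_iSup₂_of_le n hn le_rfl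
    rw [h] at this
    exact_mod_cast this
  have hb : BddAbove s := ⟨t, hle⟩
  have hmem := Nat.sSup_mem hs hb
  have : sSup s = t := by
    refine le_antisymm (hle _ hmem) ?_
    have : syz R N ≤ (sSup s : ℕ) := iSup₂_le fun n hn => by exact_mod_cast le_csSup hb hn
    rw [h] at this
    exact_mod_cast this
  rw [← this]
  exact hmem

/-- Each factor surjects onto a nonzero cyclic module, hence onto `k`; multiplying in `k` gives a
nonzero map. -/
theorem nontrivial_tensorProduct (M N : ModuleCat.{u} R) [Module.Finite R M] [Module.Finite R N]
    [Nontrivial M] [Nontrivial N] : Nontrivial (TensorProduct R M N) := by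
  obtain ⟨I, φ, hI, hφ⟩ := Module.exists_surjective_quotient_of_finite R M
  obtain ⟨J, ψ, hJ, hψ⟩ := Module.exists_surjective_quotient_of_finite R N
  let χ : TensorProduct R M N →ₗ[R] R ⧸ maximalIdeal R :=
    LinearMap.mul' R _ ∘ₗ TensorProduct.map
      ((Ideal.Quotient.factorₐ R (le_maximalIdeal hI)).toLinearMap ∘ₗ φ)
      ((Ideal.Quotient.factorₐ R (le_maximalIdeal hJ)).toLinearMap ∘ₗ ψ)
  obtain ⟨x, hx⟩ := hφ 1
  obtain ⟨y, hy⟩ := hψ 1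
  have h : χ (x ⊗ₜ y) = 1 := by simp [χ, hx, hy]
  refine ⟨x ⊗ₜ y, 0, fun h₀ => ?_⟩
  rw [h₀, map_zero] at h
  exact zero_ne_one h

variable [IsNoetherianRing R]

theorem hom_residue_subsingleton_of_torVanishes (X M : ModuleCat.{u} R) [Module.Finite R M]
    {q : ℕ} (hM : HasProjectiveDimensionLT M (q + 2)) (hM' : ¬ HasProjectiveDimensionLT M (q + 1))
    (h : TorVanishes R (q + 1) X M) : Subsingleton (Ext (residueModule R) X 0) := by
  induction q generalizing M with
  | succ q ih =>
    obtain ⟨F, p, _, _, hp, hmin⟩ := exists_minimal_cover M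
    have hS := LinearMap.shortExact_shortComplexKer hp
    have : Projective (ModuleCat.of R F) :=
      (IsProjective.iff_projective (R := R) F).1 Module.Projective.of_free
    obtain ⟨hK, hK'⟩ := syzygy_projectiveDimension hS hM hM'
    exact ih (ModuleCat.of R (LinearMap.ker p)) hK hK'
      ((torVanishes_succ_succ_iff X hS q).1 h)
  | zero =>
    obtain ⟨F, p, _, _, hp, hmin⟩ := exists_minimal_cover M
    have hS := LinearMap.shortExact_shortComplexKer hp
    have : Projective (ModuleCat.of R F) :=
      (IsProjective.iff_projective (R := R) F).1 Module.Projective.of_free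
    obtain ⟨hK, hK'⟩ := syzygy_projectiveDimension hS hM hM'
    have : Module.Free R (LinearMap.ker p) :=
      free_of_hasProjectiveDimensionLT_one (K := ModuleCat.of R (LinearMap.ker p)) hK
    have : Nontrivial (LinearMap.ker p) :=
      nontrivial_of_not_hasProjectiveDimensionLT (K := ModuleCat.of R (LinearMap.ker p)) hK'
    have hinj : Function.Injective ((LinearMap.ker p).subtype.lTensor X) :=
      (torVanishes_one_iff X hS).1 h
    let b := Module.Free.chooseBasis R (LinearMap.ker p)
    obtain ⟨j⟩ := b.index_nonempty
    -- For a socle element `x`, `x ⊗ b j` maps to zero in `X ⊗ F` because `b j ∈ 𝔪F`; injectivity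
    -- makes it zero, and the `j`-th coordinate returns `x`.
    have hsoc : ∀ x : X, (∀ r ∈ maximalIdeal R, r • x = 0) → x = 0 := by
      intro x hx
      have h₀ : ∀ y ∈ maximalIdeal R • (⊤ : Submodule R F), TensorProduct.tmul R x y = 0 := by
        intro y hy
        induction hy using Submodule.smul_induction_on' with
        | smul r hr y _ => rw [← TensorProduct.smul_tmul, hx r hr, TensorProduct.zero_tmul]
        | add y _ y' _ hy hy' => rw [TensorProduct.tmul_add, hy, hy', add_zero]
      have h₁ : TensorProduct.tmul R x (b j) = 0 := by
        apply hinj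
        rw [map_zero]
        exact h₀ _ (hmin (b j).2)
      have h₂ := congrArg (fun z => TensorProduct.rid R X ((b.coord j).lTensor X z)) h₁
      simpa using h₂
    have : Subsingleton (residueModule R ⟶ X) := by
      refine subsingleton_of_forall_eq 0 fun φ => ?_
      have h₁ : φ.hom (Ideal.Quotient.mk _ 1) = 0 := by
        refine hsoc _ fun r hr => ?_
        rw [← map_smul]
        have : r • (Ideal.Quotient.mk (maximalIdeal R) 1) = 0 := by
          rw [← Ideal.Quotient.mk_eq_mk, ← Submodule.Quotient.mk_smul]
          exact Ideal.Quotient.eq_zero_iff_mem.2 (by simpa using hr)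
        exact (congrArg φ.hom this).trans (map_zero _)
      ext
      exact h₁
    exact Ext.homEquiv₀.subsingleton_congr.2 this

theorem le_depth_of_ext_residue_subsingleton (N : ModuleCat.{u} R) [Module.Finite R N]
    [Nontrivial N] (n : ℕ) (h : ∀ i < n, Subsingleton (Ext (residueModule R) N i)) :
    (n : ℕ∞) ≤ depth R N := by
  have hsupp : Module.support R (residueModule R) =
      PrimeSpectrum.zeroLocus (maximalIdeal R : Set R) := by
    rw [Module.support_eq_zeroLocus, Ideal.annihilator_quotient]
  obtain ⟨rs, hlen, hmem, hreg⟩ := ModuleCat.exists_isRegular_of_exists_subsingleton_ext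
    (maximalIdeal R) n N (smul_top_lt_top N) (residueModule R) hsupp h
  rw [← hlen]
  exact le_iSup₂_of_le rs ⟨hmem, hreg.toIsWeaklyRegular⟩ le_rfl

/-- Each term of a regular sequence lowers the dimension of the support by one, and `R` has finite
Krull dimension. -/
theorem depth_ne_top (N : ModuleCat.{u} R) [Module.Finite R N] [Nontrivial N] :
    depth R N ≠ ⊤ := by
  obtain ⟨n, hn⟩ : ∃ n : ℕ, ringKrullDim R ≤ n := by
    have h := ringKrullDim_ne_top (R := R)
    generalize ringKrullDim R = a at h
    induction a with
    | bot => exact ⟨0, bot_le⟩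
    | coe a =>
      obtain ⟨n, rfl⟩ := ENat.ne_top_iff_exists.1 fun ha : a = ⊤ => h (by rw [ha]; rfl)
      exact ⟨n, le_rfl⟩
  refine ne_top_of_le_ne_top (ENat.natCast_ne_top n) (iSup₂_le fun rs hrs => ?_)
  have hreg := RingTheory.Sequence.IsRegular.of_isWeaklyRegular_of_mem_maximalIdeal N hrs.1 hrs.2
  have := hreg.quot_ofList_smul_nontrivial ⊤
  have : Nonempty (Module.support R (N ⧸ Ideal.ofList rs • (⊤ : Submodule R N))) :=
    Module.nonempty_support_of_nontrivial.to_subtype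
  have h := Module.supportDim_add_length_eq_supportDim_of_isRegular rs hreg
  have h' : (rs.length : WithBot ℕ∞) ≤ n :=
    calc (rs.length : WithBot ℕ∞) = 0 + rs.length := (zero_add _).symm
      _ ≤ _ := add_le_add_left (Order.krullDim_nonneg) _
      _ = _ := h
      _ ≤ n := (Module.supportDim_le_ringKrullDim R N).trans hn
  exact_mod_cast h'

end Depth

/-! ### The supremum of nonvanishing Tor -/

section Main

open IsLocalRing Abelian

variable {R : Type u} [CommRing R]

theorem torSup_eq_top {X Y : ModuleCat.{u} R} (h : ∀ n, 1 ≤ n → ¬ TorVanishes R n X Y) :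
    torSup R X Y = ((⊤ : ℕ∞) : WithBot ℕ∞) := by
  have hle : ∀ n : ℕ, ((n : ℕ∞) : WithBot ℕ∞) ≤ torSup R X Y := fun n =>
    (WithBot.coe_le_coe.2 (by exact_mod_cast n.le_succ)).trans
      (le_iSup₂_of_le (n + 1) (h _ (by lia)) le_rfl)
  generalize torSup R X Y = a at hle ⊢
  induction a with
  | bot => exact absurd (hle 0) (WithBot.bot_lt_coe _).not_ge
  | coe a =>
    congr 1
    rw [ENat.eq_top_iff_forall_ge]
    exact fun n => WithBot.coe_le_coe.1 (hle n)

theorem torSup_eq_coe {X Y : ModuleCat.{u} R} {m : ℕ} (h : ¬ TorVanishes R m X Y)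
    (h' : ∀ n, m < n → TorVanishes R n X Y) : torSup R X Y = ((m : ℕ∞) : WithBot ℕ∞) := by
  refine le_antisymm (iSup₂_le fun n hn => ?_) (le_iSup₂_of_le m h le_rfl)
  rw [WithBot.coe_le_coe, Nat.cast_le]
  exact not_lt.1 fun hmn => hn (h' n hmn)

theorem hasProjectiveDimensionLT_of_pd_eq {M : ModuleCat.{u} R} [Nontrivial M] {p : ℕ}
    (h : pd R M = p) : HasProjectiveDimensionLT M (p + 1) ∧ ¬ HasProjectiveDimensionLT M p := by
  have hp := coe_pd R M
  rw [h] at hp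
  exact ⟨(projectiveDimension_le_iff M p).1 hp.symm.le, (projectiveDimension_ge_iff M p).1 hp.le⟩

variable [IsLocalRing R] [IsNoetherianRing R]

theorem not_torVanishes_sub {M N X : ModuleCat.{u} R} [Module.Finite R M] [Module.Finite R N]
    [Nontrivial M] [Nontrivial N] {t p : ℕ} (hX : IsMinimalSyzygy R t X N)
    (ht : depth R N = t) (htp : t ≤ p) (hM : HasProjectiveDimensionLT M (p + 1))
    (hM' : ¬ HasProjectiveDimensionLT M p) : ¬ TorVanishes R (p - t) M N := by
  intro h
  obtain rfl | hlt := htp.eq_or_lt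
  · rw [Nat.sub_self, torVanishes_zero_iff] at h
    exact not_nontrivial_iff_subsingleton.2 h (nontrivial_tensorProduct M N)
  · obtain ⟨q, rfl⟩ : ∃ q, p = q + t + 1 := ⟨p - t - 1, by lia⟩
    rw [show q + t + 1 - t = q + 1 by lia, hX.torVanishes_iff, torVanishes_succ_comm] at h
    have h₀ := hom_residue_subsingleton_of_torVanishes X M hM hM' h
    -- `s = 1` records `Hom(k, X) = 0`; the range `i < 1 + t` is available for `R` because `1 + t ≤
    -- pd M`.
    have hN := hX.ext_residue_subsingleton (s := 1)
      (fun i hi => ext_residue_ring_subsingleton M hM hM' (by lia))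
      (fun i hi => by obtain rfl : i = 0 := by lia
                      exact h₀)
    have := le_depth_of_ext_residue_subsingleton N _ hN
    rw [ht, Nat.cast_le] at this
    lia

end Main

end RigidTest

theorem mainTheorem12 (R : Type u) [CommRing R] [IsLocalRing R] [IsNoetherianRing R]
    (M N : ModuleCat.{u} R) [Module.Finite R M] [Module.Finite R N] [Nontrivial M] [Nontrivial N]
    (hN : RigidTest.IsRigidTest R N)
    (hsyz : RigidTest.syz R N = RigidTest.depth R N)
    (hpd : RigidTest.depth R N ≤ RigidTest.pd R M) :
    RigidTest.torSup R M N =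
      ((RigidTest.pd R M - RigidTest.depth R N : ℕ∞) : WithBot ℕ∞) := by
  obtain ⟨t, ht⟩ := ENat.ne_top_iff_exists.1 (RigidTest.depth_ne_top N)
  by_cases hM : RigidTest.pd R M = ⊤
  · rw [hM, ← ht, ENat.top_sub_natCast]
    refine RigidTest.torSup_eq_top fun n hn h => ?_
    obtain ⟨n, rfl⟩ := Nat.exists_eq_add_of_le' hn
    rw [RigidTest.torVanishes_succ_comm] at h
    have := (hN M inferInstance (n + 1) hn h).2
    rw [← RigidTest.coe_pd R M, hM] at this
    exact this.ne rfl
  · obtain ⟨p, hp⟩ := ENat.ne_top_iff_exists.1 hM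
    obtain ⟨hLT, hLT'⟩ := RigidTest.hasProjectiveDimensionLT_of_pd_eq hp.symm
    obtain ⟨X, _, hX⟩ := RigidTest.exists_isMinimalSyzygy_of_syz_eq N (hsyz.trans ht.symm)
    rw [← hp, ← ht, Nat.cast_le] at hpd
    rw [← hp, ← ht, ← ENat.natCast_sub]
    refine RigidTest.torSup_eq_coe (RigidTest.not_torVanishes_sub hX ht.symm hpd hLT hLT')
      fun n hn => ?_
    obtain ⟨n, rfl⟩ := Nat.exists_eq_add_of_le' (Nat.one_le_of_lt hn)
    rw [hX.torVanishes_iff, RigidTest.torVanishes_succ_comm]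
    exact RigidTest.torVanishes_of_hasProjectiveDimensionLT X M _
      (CategoryTheory.hasProjectiveDimensionLT_of_ge M (p + 1) _ (by lia))
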